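/- **Setting.** Fix a function-free first-order signature (without equality) with set of predicate symbols $\mathbf P$ and set of constants $\Delta$ (standard names: constants denote themselves and quantifiers range over $\Delta$). Formulae are built from atoms by $\lnot,\land,\exists$ and the modal operators $\mathbf K,\mathbf{not}$. An interpretation is a set of ground atoms; $\mathcal I$ is the set of all of them; an MKNF interpretation is a nonempty $M\subseteq\mathcal I$. A ground atom is true in $(I,M,N)$ iff it belongs to $I$; $\lnot,\land,\exists$ are as usual; $\mathbf K\phi$ holds in $(I,M,N)$ iff $\phi$ holds in $(J,M,N)$ for all $J\in M$, and $\mathbf{not}\,\phi$ iff $\phi$ fails in $(J,M,N)$ for some $J\in N$. For $M\subseteq\mathcal I$ and a set $T$ of sentences, $M\models T$ means that every $\phi\in T$ holds in $(I,M,M)$ for all $I\in M$; $\mathsf{mod}(T)$ is the greatest $M\subseteq\mathcal I$ with $M\models T$ (it exists for first-order $T$). $\mathsf{pr}(\cdot)$ denotes the set of predicate symbols occurring in an expression. *Minimal change update.* Write $J\le_I J'$ if for every $P\in\mathbf P$ the set of $P$-atoms on which $I,J$ differ is contained in the set of $P$-atoms on which $I,J'$ differ, and $J<_IJ'$ if $J\le_IJ'$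 and not $J'\le_IJ$. Put $M\oplus N=\bigcup_{I\in M}\{J\in N\mid \text{there is no } J'\in N \text{ with } J'<_IJ\}$. The minimal change update model of a finite sequence $\langle T_i\rangle_{i<n}$ of first-order theories is $(\cdots(\mathcal I\oplus\mathsf{mod}(T_0))\oplus\cdots)\oplus\mathsf{mod}(T_{n-1})$, if this set is nonempty (for $n=0$ it is $\mathcal I$). *Dynamic logic programs.* A literal is a ground atom $p$ or a default literal $\sim p$ (with $\sim\sim p=p$). A rule $r$ has a head literal $H(r)$ and a finite set $B(r)$ of body literals; it is positive if $H(r)$ is an atom, and a fact if $B(r)=\emptyset$. A program is a set of rules. For an interpretation $I$, $I\models p$ iff $p\in I$, and $I\models{\sim}p$ iff $p\notin I$. For a finite sequence $P=\langle P_i\rangle_{i<n}$ of programs, an occurrence of a rule $r\in P_i$ at position $i$ is rejected by $I$ if some $r'\in P_j$ with $i\le j$ has $H(r)={\sim}H(r')$ and $I\models B(r')$. $I$ is a dynamic stable model of $P$ if $I\cup\{\sim p\mid p\notin I\}$ is the least model, with the literals $\sim p$ treated as new atoms, of the program consisting of all rules with at least one non-rejected occurrence and the facts $\sim p$ for all ground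 atoms $p$ such that no rule $r$ of any $P_i$ has $H(r)=p$ and $I\models B(r)$. *Hybrid knowledge bases.* A description logic is given by a set of axioms $\phi$, each with a translation $\mathsf{fo}(\phi)$ into a first-order sentence; $\mathsf{pr}(\phi)=\mathsf{pr}(\mathsf{fo}(\phi))$. A hybrid knowledge base is a pair $\langle\mathcal O,\mathcal P\rangle$ of a set of axioms and a program; a dynamic one is a finite sequence $\mathcal K=\langle\mathcal K_i\rangle_{i<n}$ with $\mathcal K_i=\langle\mathcal O_i,\mathcal P_i\rangle$. $\mathcal K$ is $\mathcal O$-based if every $\mathcal P_i$ contains only positive facts, $\mathcal P$-based if every $\mathcal O_i$ is empty, and basic if it is one or the other. An MKNF interpretation $M$ is a *dynamic MKNF model* of a basic $\mathcal K$ if either $\mathcal K$ is $\mathcal O$-based and $M$ is the minimal change update model of $\langle\mathsf{fo}(\mathcal O_i)\cup\mathcal P_i\rangle_{i<n}$ (facts read as ground atoms), or $\mathcal K$ is $\mathcal P$-based and $M=\{J\in\mathcal I\mid I\subseteq J\}$ for some dynamic stable model $I$ of $\langle\mathcal P_i\rangle_{i<n}$. *Splitting.* $U\subseteq\mathbf P$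 is a splitting set for $\langle\mathcal O,\mathcal P\rangle$ if $\mathsf{pr}(\phi)\subseteq U$ for every $\phi\in\mathcal O$ with $\mathsf{pr}(\phi)\cap U\ne\emptyset$, and $\mathsf{pr}(r)\subseteq U$ for every $r\in\mathcal P$ with $\mathsf{pr}(H(r))\cap U\neq\emptyset$. The bottom $b_U$ keeps the axioms and rules whose predicate symbols all lie in $U$, and the top $t_U$ the others. For $X\subseteq\mathcal I$, $e_U(\langle\mathcal O,\mathcal P\rangle,X)$ consists of the axioms of the top and, for each rule $r$ of the top such that $X\models\mathbf Kp$ for every atom $p\in B(r)$ with predicate symbol in $U$ and $X\models\mathbf{not}\,p$ for every default literal ${\sim}p\in B(r)$ with predicate symbol in $U$, the rule with head $H(r)$ and body $\{L\in B(r)\mid\mathsf{pr}(L)\subseteq\mathbf P\setminus U\}$. A splitting sequence for a knowledge base is a sequence $\langle U_\alpha\rangle_{\alpha<\mu}$ of splitting sets, indexed by the ordinals below an ordinal $\mu$, that is monotone and continuous ($U_\alpha=\bigcup_{\eta<\alpha}U_\eta$ for limit ordinals $\alpha<\mu$) with $\bigcup_{\alpha<\mu}U_\alpha=\mathbf P$;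 for a dynamic $\mathcal K$ it has to be a splitting sequence for every $\mathcal K_i$, and $b_U$, $t_U$, $e_U$ are applied to each $\mathcal K_i$. A dynamic $\mathcal K$ is reducible relative to $V\subseteq\mathbf P$ if either all rules in all $\mathcal P_i$ are positive with $\mathsf{pr}(B(r))\subseteq V$, or all $\mathcal O_i$ are empty. A splitting sequence $U$ for $\mathcal K$ is update-enabling if $b_{U_0}(\mathcal K)$ is reducible relative to $\emptyset$ and $t_{U_\alpha}(b_{U_{\alpha+1}}(\mathcal K))$ is reducible relative to $U_\alpha$ whenever $\alpha+1<\mu$. An MKNF interpretation $M$ is a *dynamic MKNF model of $\mathcal K$ with respect to $U$* if $U$ is an update-enabling splitting sequence for $\mathcal K$ and $M=\bigcap_{\alpha<\mu}X_\alpha$ for some sequence $\langle X_\alpha\rangle_{\alpha<\mu}$ of MKNF interpretations such that $X_0$ is a dynamic MKNF model of $b_{U_0}(\mathcal K)$; $X_{\alpha+1}$ is a dynamic MKNF model of $e_{U_\alpha}\bigl(b_{U_{\alpha+1}}(\mathcal K),\bigcap_{\eta\le\alpha}X_\eta\bigr)$ whenever $\alpha+1<\mu$; and $X_\alpha=\mathcal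 I$ for every limit ordinal $\alpha<\mu$. **Corollary (compatibility).** Let $\mathcal K$ be a basic dynamic hybrid knowledge base and let $U=\langle U_\alpha\rangle_{\alpha<\mu}$ be a splitting sequence for $\mathcal K$. Then, for every $M\subseteq\mathcal I$, $M$ is a dynamic MKNF model of $\mathcal K$ if and only if $M$ is a dynamic MKNF model of $\mathcal K$ with respect to $U$. -/

import Mathlib

universe u v w x

namespace HybridMKNF

/-! ## Function-free first-order syntax with the modal operators `K` and `not` -/

/-- A function-free first-order signature: predicate symbols with arities, and constants.
Under the standard names assumption `Const` is the Herbrand universe `Δ`. -/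
structure Signature where
  Pred : Type u
  arity : Pred → ℕ
  Const : Type v

/-- Terms with `n` free variables. -/
inductive Term (S : Signature.{u, v}) (n : ℕ) : Type v
  | var (i : Fin n) : Term S n
  | const (c : S.Const) : Term S n

/-- MKNF formulae with free variables among `n` variables; `ex` binds the last one. -/
inductive Formula (S : Signature.{u, v}) : ℕ → Type (max u v)
  | atom {n : ℕ} (P : S.Pred) (ts : Fin (S.arity P) → Term S n) : Formula S n
  | neg {n : ℕ} (φ : Formula S n) : Formula S n
  | and {n : ℕ} (φ ψ : Formula S n) : Formula S n
  | ex {n : ℕ} (φ : Formula S (n + 1)) : Formula S n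
  | know {n : ℕ} (φ : Formula S n) : Formula S n
  | mnot {n : ℕ} (φ : Formula S n) : Formula S n

/-- Sentences: formulae without free variables. -/
abbrev Sentence (S : Signature.{u, v}) := Formula S 0

namespace Formula

/-- The set of predicate symbols relevant to a formula. -/
def preds {S : Signature.{u, v}} : {n : ℕ} → Formula S n → Set S.Pred
  | _, atom P _ => {P}
  | _, neg φ => preds φ
  | _, and φ ψ => preds φ ∪ preds ψ
  | _, ex φ => preds φ
  | _, know φ => preds φ
  | _, mnot φ => preds φ

/-- A formula is first-order if it contains no modal operators. -/
def IsFirstOrder {S : Signature.{u, v}} : {n : ℕ} → Formula S n → Prop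
  | _, atom _ _ => True
  | _, neg φ => IsFirstOrder φ
  | _, and φ ψ => IsFirstOrder φ ∧ IsFirstOrder ψ
  | _, ex φ => IsFirstOrder φ
  | _, know _ => False
  | _, mnot _ => False

end Formula

/-! ## Herbrand interpretations and MKNF satisfaction -/

/-- Ground atoms `P(c₁, …, cₖ)`. -/
structure GroundAtom (S : Signature.{u, v}) where
  pred : S.Pred
  args : Fin (S.arity pred) → S.Const

/-- A ground atom as a sentence. -/
def GroundAtom.toSentence {S : Signature.{u, v}} (p : GroundAtom S) : Sentence S :=
  Formula.atom p.pred (fun i => Term.const (p.args i))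

/-- A Herbrand interpretation is a set of ground atoms (those that are true in it). -/
abbrev Interp (S : Signature.{u, v}) := Set (GroundAtom S)

/-- The value of a term when constants are substituted for its variables. -/
def Term.eval {S : Signature.{u, v}} {n : ℕ} (e : Fin n → S.Const) : Term S n → S.Const
  | var i => e i
  | const c => c

/-- Satisfaction in the MKNF structure `(I, M, N)` of a formula in which the constants `e`
have been substituted for the free variables. -/
def Formula.Sat {S : Signature.{u, v}} (M N : Set (Interp S)) :
    {n : ℕ} → Interp S → (Fin n → S.Const) → Formula S n → Prop
  | _, I, e, atom P ts => GroundAtom.mk P (fun i => (ts i).eval e) ∈ I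
  | _, I, e, neg φ => ¬ Sat M N I e φ
  | _, I, e, and φ ψ => Sat M N I e φ ∧ Sat M N I e ψ
  | _, I, e, ex φ => ∃ c : S.Const, Sat M N I (Fin.snoc e c) φ
  | _, _, e, know φ => ∀ J ∈ M, Sat M N J e φ
  | _, _, e, mnot φ => ∃ J ∈ N, ¬ Sat M N J e φ

/-- `M ⊨ T` for a set `M` of interpretations and a set `T` of MKNF sentences. -/
def Models {S : Signature.{u, v}} (M : Set (Interp S)) (T : Set (Sentence S)) : Prop :=
  ∀ φ ∈ T, ∀ I ∈ M, φ.Sat M M I Fin.elim0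

/-- `M = mod(T)`: `M` is the greatest set of interpretations with `M ⊨ T`. -/
def IsMod {S : Signature.{u, v}} (T : Set (Sentence S)) (M : Set (Interp S)) : Prop :=
  IsGreatest {N | Models N T} M

/-! ## Minimal change update -/

/-- `diff(P, I, J)`. -/
def diff {S : Signature.{u, v}} (P : S.Pred) (I J : Interp S) : Set (GroundAtom S) :=
  ({p ∈ I | p.pred = P} \ {p ∈ J | p.pred = P}) ∪ ({p ∈ J | p.pred = P} \ {p ∈ I | p.pred = P})

/-- `J ≤_I J'`: `J` is at least as close to `I` as `J'`. -/
def CloserEq {S : Signature.{u, v}} (I J J' : Interp S) : Prop :=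
  ∀ P : S.Pred, diff P I J ⊆ diff P I J'

/-- `J <_I J'`: `J` is closer to `I` than `J'`. -/
def Closer {S : Signature.{u, v}} (I J J' : Interp S) : Prop :=
  CloserEq I J J' ∧ ¬ CloserEq I J' J

/-- `I ⊕ N` for an interpretation `I`. -/
def updateInterp {S : Signature.{u, v}} (I : Interp S) (N : Set (Interp S)) : Set (Interp S) :=
  {J ∈ N | ¬ ∃ J' ∈ N, Closer I J' J}

/-- `M ⊕ N` for a set of interpretations `M`. -/
def update {S : Signature.{u, v}} (M N : Set (Interp S)) : Set (Interp S) :=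
  ⋃ I ∈ M, updateInterp I N

/-- `(⋯((𝓘 ⊕ M₀) ⊕ M₁) ⊕ ⋯) ⊕ Mₙ₋₁`, where `𝓘` is the set of all interpretations. -/
def updateSeq {S : Signature.{u, v}} : (n : ℕ) → (Fin n → Set (Interp S)) → Set (Interp S)
  | 0, _ => Set.univ
  | k + 1, M => update (updateSeq k (fun i => M i.castSucc)) (M (Fin.last k))

/-- `M` is the minimal change update model of the sequence `T` of theories. -/
def IsMinimalChangeUpdateModel {S : Signature.{u, v}} {n : ℕ} (T : Fin n → Set (Sentence S))
    (M : Set (Interp S)) : Prop :=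
  M.Nonempty ∧ ∃ N : Fin n → Set (Interp S), (∀ i, IsMod (T i) (N i)) ∧ M = updateSeq n N

/-! ## Generalised and dynamic logic programs -/

/-- Literals: ground atoms and default literals. -/
inductive Literal (S : Signature.{u, v}) : Type (max u v)
  | pos (p : GroundAtom S) : Literal S
  | dneg (p : GroundAtom S) : Literal S

namespace Literal

/-- Default negation of a literal; double default negation is absorbed. -/
def lpnot {S : Signature.{u, v}} : Literal S → Literal S
  | pos p => dneg p
  | dneg p => pos p

/-- The predicate symbols occurring in a literal. -/
def preds {S : Signature.{u, v}} : Literal S → Set S.Pred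
  | pos p => {p.pred}
  | dneg p => {p.pred}

/-- `I ⊨ L`. -/
def Holds {S : Signature.{u, v}} (I : Interp S) : Literal S → Prop
  | pos p => p ∈ I
  | dneg p => p ∉ I

/-- The translation `π`: `π(p) = K p` and `π(not p) = not p`. -/
def toMKNF {S : Signature.{u, v}} : Literal S → Sentence S
  | pos p => Formula.know p.toSentence
  | dneg p => Formula.mnot p.toSentence

end Literal

/-- Ground rules `L₀ ← L₁, …, Lₖ`. -/
structure Rule (S : Signature.{u, v}) where
  head : Literal S
  body : Finset (Literal S)

namespace Rule

/-- Predicate symbols occurring in the body. -/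
def bodyPreds {S : Signature.{u, v}} (r : Rule S) : Set S.Pred := ⋃ L ∈ r.body, L.preds

/-- Predicate symbols occurring in the rule. -/
def preds {S : Signature.{u, v}} (r : Rule S) : Set S.Pred := r.head.preds ∪ r.bodyPreds

/-- The head is an atom. -/
def IsPositive {S : Signature.{u, v}} (r : Rule S) : Prop := ∃ p, r.head = Literal.pos p

/-- The body is empty. -/
def IsFact {S : Signature.{u, v}} (r : Rule S) : Prop := r.body = ∅

/-- `I ⊨ B(r)`. -/
def BodyHolds {S : Signature.{u, v}} (I : Interp S) (r : Rule S) : Prop :=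
  ∀ L ∈ r.body, L.Holds I

/-- `r ⋈ r'`: the heads are complementary. -/
def Conflicting {S : Signature.{u, v}} (r r' : Rule S) : Prop := r.head = r'.head.lpnot

end Rule

/-- The least model of a program in which each default literal `not p` is read as a fresh
atom; the literal `dneg p` itself plays the role of the fresh atom. -/
def least {S : Signature.{u, v}} (Q : Set (Rule S)) : Set (Literal S) :=
  ⋂₀ {A | ∀ r ∈ Q, (∀ L ∈ r.body, L ∈ A) → r.head ∈ A}

/-- `I' = I ∪ {not p | p ∉ I}`. -/
def withDefaults {S : Signature.{u, v}} (I : Interp S) : Set (Literal S) :=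
  {L | L.Holds I}

/-- `ρ(P)`: the multiset of all rules of `P`. A rule that belongs to several members of the
sequence occurs once for each of them, so an occurrence is a rule with its position. -/
def allRules {S : Signature.{u, v}} {n : ℕ} (P : Fin n → Set (Rule S)) :
    Set (Fin n × Rule S) :=
  {o | o.2 ∈ P o.1}

/-- `rej(P, I)`: the rejected rule occurrences. -/
def rejected {S : Signature.{u, v}} {n : ℕ} (P : Fin n → Set (Rule S)) (I : Interp S) :
    Set (Fin n × Rule S) :=
  {o | o.2 ∈ P o.1 ∧ ∃ (j : Fin n) (r' : Rule S),
    r' ∈ P j ∧ o.1 ≤ j ∧ o.2.Conflicting r' ∧ r'.BodyHolds I}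

/-- `def(P, I)`: the default assumptions, as facts. -/
def defaults {S : Signature.{u, v}} {n : ℕ} (P : Fin n → Set (Rule S)) (I : Interp S) :
    Set (Rule S) :=
  {d | ∃ p : GroundAtom S, d = ⟨Literal.dneg p, ∅⟩ ∧
    ¬ ∃ o ∈ allRules P, o.2.head = Literal.pos p ∧ o.2.BodyHolds I}

/-- `I` is a dynamic stable model of the dynamic logic program `P`. -/
def IsDynamicStableModel {S : Signature.{u, v}} {n : ℕ} (P : Fin n → Set (Rule S))
    (I : Interp S) : Prop :=
  withDefaults I = least (Prod.snd '' (allRules P \ rejected P I) ∪ defaults P I)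

/-! ## Hybrid knowledge bases -/

/-- A description logic: a language of ontology statements with a translation into
function-free first-order sentences. -/
structure DescriptionLogic (S : Signature.{u, v}) where
  Stmt : Type w
  fo : Stmt → Sentence S
  isFirstOrder_fo : ∀ φ, (fo φ).IsFirstOrder

/-- The predicate symbols relevant to an ontology statement. -/
def DescriptionLogic.preds {S : Signature.{u, v}} (D : DescriptionLogic.{u, v, w} S)
    (φ : D.Stmt) : Set S.Pred :=
  (D.fo φ).preds

/-- A hybrid knowledge base: an ontology and a generalised logic program. -/
structure HybridKB {S : Signature.{u, v}} (D : DescriptionLogic.{u, v, w} S) where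
  ont : Set D.Stmt
  prog : Set (Rule S)

namespace HybridKB

variable {S : Signature.{u, v}} {D : DescriptionLogic.{u, v, w} S}

/-- `U` is a splitting set for `K`. -/
def IsSplittingSet (K : HybridKB D) (U : Set S.Pred) : Prop :=
  (∀ φ ∈ K.ont, (D.preds φ ∩ U).Nonempty → D.preds φ ⊆ U) ∧
  (∀ r ∈ K.prog, (r.head.preds ∩ U).Nonempty → r.preds ⊆ U)

/-- The bottom `b_U(K)`. -/
def bottom (U : Set S.Pred) (K : HybridKB D) : HybridKB D where
  ont := {φ ∈ K.ont | D.preds φ ⊆ U}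
  prog := {r ∈ K.prog | r.preds ⊆ U}

/-- The top `t_U(K)`. -/
def top (U : Set S.Pred) (K : HybridKB D) : HybridKB D where
  ont := K.ont \ (bottom U K).ont
  prog := K.prog \ (bottom U K).prog

/-- The splitting set reduct `e_U(K, X)`. -/
def reduct (U : Set S.Pred) (K : HybridKB D) (X : Set (Interp S)) : HybridKB D where
  ont := (top U K).ont
  prog := {r' | ∃ r ∈ (top U K).prog,
    Models X (Literal.toMKNF '' {L | L ∈ r.body ∧ L.preds ⊆ U}) ∧
    r'.head = r.head ∧
    (r'.body : Set (Literal S)) = {L | L ∈ r.body ∧ L.preds ⊆ Uᶜ}}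

/-- Ontology-based: the program contains only positive facts. -/
def IsOntBased (K : HybridKB D) : Prop := ∀ r ∈ K.prog, r.IsPositive ∧ r.IsFact

/-- Program-based: the ontology is empty. -/
def IsProgBased (K : HybridKB D) : Prop := K.ont = ∅

/-- The first-order theory of an ontology-based knowledge base: the translated ontology
together with the atoms that are positive facts of the program. -/
def theory (K : HybridKB D) : Set (Sentence S) :=
  D.fo '' K.ont ∪ {φ | ∃ p : GroundAtom S, (⟨Literal.pos p, ∅⟩ : Rule S) ∈ K.prog ∧
    φ = p.toSentence}

/-- Ontology-reducible relative to `U`. -/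
def IsOntReducible (U : Set S.Pred) (K : HybridKB D) : Prop :=
  ∀ r ∈ K.prog, r.IsPositive ∧ r.bodyPreds ⊆ U

/-- Program-reducible (relative to any set). -/
def IsProgReducible (K : HybridKB D) : Prop := K.ont = ∅

/-- `⟨U_α⟩_{α < μ}` is a splitting sequence for `K`; only the values of `U` below `μ` matter. -/
structure IsSplittingSequence (K : HybridKB D) (μ : Ordinal.{x})
    (U : Ordinal.{x} → Set S.Pred) : Prop where
  splitting : ∀ α < μ, K.IsSplittingSet (U α)
  monotone : ∀ α β, α ≤ β → β < μ → U α ⊆ U β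
  continuous : ∀ α < μ, Order.IsSuccLimit α → U α = ⋃ η < α, U η
  cover : ⋃ α < μ, U α = Set.univ

end HybridKB

/-! ## Dynamic hybrid knowledge bases -/

/-- A dynamic hybrid knowledge base of length `n`. -/
abbrev DynamicHybridKB {S : Signature.{u, v}} (D : DescriptionLogic.{u, v, w} S) (n : ℕ) :=
  Fin n → HybridKB D

namespace DynamicHybridKB

variable {S : Signature.{u, v}} {D : DescriptionLogic.{u, v, w} S} {n : ℕ}

def bottom (U : Set S.Pred) (K : DynamicHybridKB D n) : DynamicHybridKB D n :=
  fun i => (K i).bottom U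

def top (U : Set S.Pred) (K : DynamicHybridKB D n) : DynamicHybridKB D n :=
  fun i => (K i).top U

def reduct (U : Set S.Pred) (K : DynamicHybridKB D n) (X : Set (Interp S)) :
    DynamicHybridKB D n :=
  fun i => (K i).reduct U X

def IsOntBased (K : DynamicHybridKB D n) : Prop := ∀ i, (K i).IsOntBased

def IsProgBased (K : DynamicHybridKB D n) : Prop := ∀ i, (K i).IsProgBased

def IsBasic (K : DynamicHybridKB D n) : Prop := K.IsOntBased ∨ K.IsProgBased

/-- `M` is a dynamic MKNF model of the basic dynamic hybrid knowledge base `K`. -/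
def IsDynamicMKNFModel (K : DynamicHybridKB D n) (M : Set (Interp S)) : Prop :=
  M.Nonempty ∧
  ((K.IsOntBased ∧ IsMinimalChangeUpdateModel (fun i => (K i).theory) M) ∨
   (K.IsProgBased ∧ ∃ I : Interp S, IsDynamicStableModel (fun i => (K i).prog) I ∧
      M = {J | I ⊆ J}))

def IsSplittingSequence (K : DynamicHybridKB D n) (μ : Ordinal.{x})
    (U : Ordinal.{x} → Set S.Pred) : Prop :=
  ∀ i, (K i).IsSplittingSequence μ U

/-- Reducible relative to `U`: ontology-reducible or program-reducible. -/
def IsReducible (U : Set S.Pred) (K : DynamicHybridKB D n) : Prop :=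
  (∀ i, (K i).IsOntReducible U) ∨ (∀ i, (K i).IsProgReducible)

/-- `⟨U_α⟩_{α < μ}` is an update-enabling splitting sequence for `K`. -/
structure IsUpdateEnabling (K : DynamicHybridKB D n) (μ : Ordinal.{x})
    (U : Ordinal.{x} → Set S.Pred) : Prop where
  splitting : K.IsSplittingSequence μ U
  zero : 0 < μ → IsReducible ∅ (K.bottom (U 0))
  succ : ∀ α, α + 1 < μ → IsReducible (U α) ((K.bottom (U (α + 1))).top (U α))

/-- `⟨X_α⟩_{α < μ}` is a solution to `K` with respect to `⟨U_α⟩_{α < μ}`. -/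
structure IsSolution (K : DynamicHybridKB D n) (μ : Ordinal.{x})
    (U : Ordinal.{x} → Set S.Pred) (X : Ordinal.{x} → Set (Interp S)) : Prop where
  nonempty : ∀ α < μ, (X α).Nonempty
  zero : 0 < μ → IsDynamicMKNFModel (K.bottom (U 0)) (X 0)
  succ : ∀ α, α + 1 < μ →
    IsDynamicMKNFModel ((K.bottom (U (α + 1))).reduct (U α) (⋂ η ≤ α, X η)) (X (α + 1))
  limit : ∀ α < μ, Order.IsSuccLimit α → X α = Set.univ

/-- `M` is a dynamic MKNF model of `K` with respect to the update-enabling splitting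
sequence `⟨U_α⟩_{α < μ}`. -/
def IsDynamicMKNFModelWrt (K : DynamicHybridKB D n) (μ : Ordinal.{x})
    (U : Ordinal.{x} → Set S.Pred) (M : Set (Interp S)) : Prop :=
  K.IsUpdateEnabling μ U ∧ M.Nonempty ∧
    ∃ X : Ordinal.{x} → Set (Interp S), K.IsSolution μ U X ∧ M = ⋂ α < μ, X α

end DynamicHybridKB

end HybridMKNF

namespace HybridMKNF

/-! ## First-order theories and their models -/

section FirstOrder

variable {S : Signature.{u, v}}

/-! A splitting sequence amounts to a level function: if `β Q` is the least index at which `Q`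
enters the sequence, then `U α = {Q | β Q ≤ α}`. By the splitting conditions, all predicates of an
axiom share one level, and no body literal of a rule lies above its head. The stages of a solution
then take one uniform form: stage `α` solves the part of `K` on level exactly `α`, simplified by the
stages below. This covers stage zero, where nothing lies below, and limit stages, where continuity
leaves the level empty and the only model is the set of all interpretations
(`isSolution_iff_isLevelSolution`).

It remains to decompose each update semantics along levels. For ontologies, closeness of
interpretations is tested atom by atom and every sentence lives on one level, so update by an
intersection of level theories is the intersection of the levelwise updates (`updateSeq_iInter`).
For programs, conflicting rules have heads with the same predicate, so rejection never crosses
levels; `I` is dynamic stable exactly when its part on each level is dynamic stable for that level's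
program, with lower body literals evaluated in `I` (`IsDynamicStableModel.level`,
`IsDynamicStableModel.of_level`). Intersecting sets `{J | A ⊆ J}` corresponds to taking unions of
the `A`.

A basic knowledge base may be of both kinds; it then contains only positive facts and both semantics
accumulate them, so the notion of model is unambiguous. -/

lemma Formula.preds_nonempty {n : ℕ} (φ : Formula S n) : φ.preds.Nonempty := by
  induction φ with
  | atom P ts => exact ⟨P, rfl⟩
  | and φ ψ ih _ => exact ih.mono Set.subset_union_left
  | neg φ ih => exact ih
  | ex φ ih => exact ih
  | know φ ih => exact ih
  | mnot φ ih => exact ih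

/-- Satisfaction of a first-order formula depends neither on the modal components nor on
atoms whose predicate symbols do not occur in it. -/
lemma Formula.sat_congr {n : ℕ} (φ : Formula S n) (hφ : φ.IsFirstOrder)
    {M N M' N' : Set (Interp S)} {I J : Interp S} (e : Fin n → S.Const)
    (h : ∀ p : GroundAtom S, p.pred ∈ φ.preds → (p ∈ I ↔ p ∈ J)) :
    φ.Sat M N I e ↔ φ.Sat M' N' J e := by
  induction φ with
  | atom P ts => exact h _ rfl
  | neg φ ih => exact not_congr (ih hφ e h)
  | and φ ψ ih₁ ih₂ =>
    exact and_congr (ih₁ hφ.1 e fun p hp => h p (Or.inl hp))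
      (ih₂ hφ.2 e fun p hp => h p (Or.inr hp))
  | ex φ ih => exact exists_congr fun c => ih hφ _ h
  | know φ ih => exact hφ.elim
  | mnot φ ih => exact hφ.elim

/-- The interpretations satisfying all sentences of a first-order theory. -/
def foModels (T : Set (Sentence S)) : Set (Interp S) :=
  {I | ∀ φ ∈ T, φ.Sat Set.univ Set.univ I Fin.elim0}

lemma isMod_iff {T : Set (Sentence S)} (hT : ∀ φ ∈ T, φ.IsFirstOrder) {M : Set (Interp S)} :
    IsMod T M ↔ M = foModels T := by
  have key : ∀ N : Set (Interp S), Models N T ↔ N ⊆ foModels T := fun N =>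
    ⟨fun h I hI φ hφ => (φ.sat_congr (hT φ hφ) _ fun _ _ => Iff.rfl).1 (h φ hφ I hI),
      fun h φ hφ I hI => (φ.sat_congr (hT φ hφ) _ fun _ _ => Iff.rfl).1 (h hI φ hφ)⟩
  have hg : IsGreatest {N | Models N T} (foModels T) :=
    ⟨(key _).2 subset_rfl, fun N hN => (key N).1 hN⟩
  exact ⟨fun h => h.unique hg, fun h => h ▸ hg⟩

lemma isMinimalChangeUpdateModel_iff {n : ℕ} {T : Fin n → Set (Sentence S)}
    (hT : ∀ i, ∀ φ ∈ T i, φ.IsFirstOrder) {M : Set (Interp S)} :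
    IsMinimalChangeUpdateModel T M ↔
      M.Nonempty ∧ M = updateSeq n fun i => foModels (T i) := by
  refine and_congr_right fun _ => ⟨?_, fun h => ⟨_, fun i => (isMod_iff (hT i)).2 rfl, h⟩⟩
  rintro ⟨N, hN, rfl⟩
  congr 1
  exact funext fun i => (isMod_iff (hT i)).1 (hN i)

end FirstOrder

/-! ## Minimal change update along a partition of the predicate symbols -/

section Update

variable {S : Signature.{u, v}}

/-- Every ground atom has exactly one predicate symbol, so the inclusions for the separate
predicates merge into a single atomwise condition, here contraposed. -/
lemma closerEq_iff {I J J' : Interp S} :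
    CloserEq I J J' ↔ ∀ p, (p ∈ I ↔ p ∈ J') → (p ∈ I ↔ p ∈ J) := by
  simp only [CloserEq, diff, Set.subset_def]
  constructor
  · intro h p hp
    have := h p.pred p
    simp only [Set.mem_union, Set.mem_sdiff, Set.mem_ofPred_eq] at this
    tauto
  · intro h P p
    have := h p
    simp only [Set.mem_union, Set.mem_sdiff, Set.mem_ofPred_eq]
    tauto

lemma mem_update {M N : Set (Interp S)} {J : Interp S} :
    J ∈ update M N ↔ ∃ I ∈ M, J ∈ N ∧ ∀ J' ∈ N, CloserEq I J' J → CloserEq I J J' := by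
  simp only [update, updateInterp, Closer, Set.mem_iUnion, exists_prop, Set.mem_ofPred_eq,
    not_exists, not_and, not_not]

/-- Membership in `N` depends only on the atoms with predicate symbol in `B`. -/
def DependsOn (B : Set S.Pred) (N : Set (Interp S)) : Prop :=
  ∀ I J : Interp S, (∀ p : GroundAtom S, p.pred ∈ B → (p ∈ I ↔ p ∈ J)) → I ∈ N → J ∈ N

/-- The interpretation that agrees with `I` on `B` and with `J` elsewhere. -/
def glue (B : Set S.Pred) (I J : Interp S) : Interp S :=
  {p | (p.pred ∈ B ∧ p ∈ I) ∨ (p.pred ∉ B ∧ p ∈ J)}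

lemma mem_glue_of_mem {B : Set S.Pred} {I J : Interp S} {p : GroundAtom S} (h : p.pred ∈ B) :
    p ∈ glue B I J ↔ p ∈ I := by simp [glue, h]

lemma mem_glue_of_notMem {B : Set S.Pred} {I J : Interp S} {p : GroundAtom S}
    (h : p.pred ∉ B) : p ∈ glue B I J ↔ p ∈ J := by simp [glue, h]

lemma DependsOn.glue_mem {B : Set S.Pred} {N : Set (Interp S)} (hN : DependsOn B N)
    {I J : Interp S} (hI : I ∈ N) : glue B I J ∈ N :=
  hN I _ (fun _ hp => (mem_glue_of_mem hp).symm) hI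

lemma DependsOn.update {B : Set S.Pred} {M N : Set (Interp S)} (hM : DependsOn B M)
    (hN : DependsOn B N) : DependsOn B (update M N) := by
  intro J J' hJ h
  obtain ⟨I, hI, hJN, hmin⟩ := mem_update.1 h
  -- The new base agrees with `J'` off `B`, so only differences on `B` matter. A competitor `L` is
  -- compared with the old one by replacing it with `I` off `B`.
  refine mem_update.2 ⟨glue B I J', hM.glue_mem hI, hN _ _ hJ hJN, fun L hL hLJ => ?_⟩
  rw [closerEq_iff] at hLJ ⊢
  have h₁ := closerEq_iff.1 (hmin (glue B L I) (hN.glue_mem hL) (closerEq_iff.2 fun p hp => by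
    by_cases hB : p.pred ∈ B
    · have := hLJ p
      rw [mem_glue_of_mem hB] at this ⊢
      rw [← hJ p hB] at this
      exact this hp
    · rw [mem_glue_of_notMem hB]))
  intro p hp
  by_cases hB : p.pred ∈ B
  · have := h₁ p
    rw [mem_glue_of_mem hB] at this hp ⊢
    rw [← hJ p hB]
    exact this hp
  · rw [mem_glue_of_notMem hB]

lemma DependsOn.updateSeq {B : Set S.Pred} {n : ℕ} {N : Fin n → Set (Interp S)}
    (hN : ∀ i, DependsOn B (N i)) : DependsOn B (updateSeq n N) := by
  induction n with
  | zero => exact fun _ _ _ _ => trivial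
  | succ k ih => exact (ih fun i => hN i.castSucc).update (hN (Fin.last k))

variable {ι : Type*} {β : S.Pred → ι}

lemma update_iInter {M N : ι → Set (Interp S)} (hM : ∀ a, DependsOn (β ⁻¹' {a}) (M a))
    (hN : ∀ a, DependsOn (β ⁻¹' {a}) (N a)) :
    update (⋂ a, M a) (⋂ a, N a) = ⋂ a, update (M a) (N a) := by
  ext J
  rw [Set.mem_iInter]
  constructor
  · intro h a
    obtain ⟨I, hI, hJ, hmin⟩ := mem_update.1 h
    rw [Set.mem_iInter] at hI hJ
    -- Off class `a` this base equals `J`, which forces any competitor `L` at least as close to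
    -- equal `J` there. Hence `L` satisfies the other components too and competes with `J` in the
    -- full update.
    refine mem_update.2 ⟨glue (β ⁻¹' {a}) I J, (hM a).glue_mem (hI a), hJ a, fun L hL hLJ => ?_⟩
    rw [closerEq_iff] at hLJ ⊢
    have hoff : ∀ p : GroundAtom S, p.pred ∉ β ⁻¹' {a} → (p ∈ J ↔ p ∈ L) := fun p hp => by
      have := hLJ p
      rw [mem_glue_of_notMem hp] at this
      exact this Iff.rfl
    have hLN : L ∈ ⋂ a, N a := Set.mem_iInter.2 fun b => by
      by_cases hb : b = a
      · exact hb ▸ hL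
      · refine hN b J L (fun p hp => hoff p fun hp' => hb ?_) (hJ b)
        exact (Set.mem_singleton_iff.1 hp).symm.trans hp'
    have h₁ := closerEq_iff.1 (hmin L hLN (closerEq_iff.2 fun p hp => by
      by_cases hB : p.pred ∈ β ⁻¹' {a}
      · have := hLJ p
        rw [mem_glue_of_mem hB] at this
        exact this hp
      · rw [hp, hoff p hB]))
    intro p hp
    by_cases hB : p.pred ∈ β ⁻¹' {a}
    · rw [mem_glue_of_mem hB] at hp ⊢
      exact h₁ p hp
    · rw [mem_glue_of_notMem hB]
  · intro h
    choose I hI hJ hmin using fun a => mem_update.1 (h a)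
    have hmem : ∀ a, ∀ p : GroundAtom S, p.pred ∈ β ⁻¹' {a} →
        (p ∈ I a ↔ p ∈ {p : GroundAtom S | p ∈ I (β p.pred)}) := by
      rintro a p rfl
      exact Iff.rfl
    -- The base is assembled from the classwise bases. Minimality is tested at one atom `p` at a
    -- time, using only the class of `p` and a competitor that equals the base off this class.
    refine mem_update.2 ⟨{p | p ∈ I (β p.pred)},
      Set.mem_iInter.2 fun a => hM a _ _ (hmem a) (hI a), Set.mem_iInter.2 hJ, fun L hL hLJ => ?_⟩
    rw [closerEq_iff] at hLJ ⊢
    intro p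
    have h₁ := closerEq_iff.1 (hmin (β p.pred) (glue (β ⁻¹' {β p.pred}) L (I (β p.pred)))
      ((hN _).glue_mem (Set.mem_iInter.1 hL _)) (closerEq_iff.2 fun q hq => by
        by_cases hB : q.pred ∈ β ⁻¹' {β p.pred}
        · rw [mem_glue_of_mem hB]
          rw [hmem _ q hB] at hq ⊢
          exact hLJ q hq
        · rw [mem_glue_of_notMem hB])) p
    rwa [mem_glue_of_mem (show p.pred ∈ β ⁻¹' {β p.pred} from rfl)] at h₁

/-- Minimal change update acts independently on the classes of a partition of the predicate
symbols, provided each theory splits along the partition. -/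
lemma updateSeq_iInter {n : ℕ} {N : Fin n → ι → Set (Interp S)}
    (hN : ∀ i a, DependsOn (β ⁻¹' {a}) (N i a)) :
    updateSeq n (fun i => ⋂ a, N i a) = ⋂ a, updateSeq n fun i => N i a := by
  induction n with
  | zero => simp [updateSeq]
  | succ k ih =>
    simp only [updateSeq]
    rw [ih fun i a => hN i.castSucc a]
    exact update_iInter (fun a => DependsOn.updateSeq fun i => hN i.castSucc a) (hN (Fin.last k))

/-- Updating by sets of atoms accumulates these atoms. -/
lemma updateSeq_superset {n : ℕ} (F : Fin n → Set (GroundAtom S)) :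
    updateSeq n (fun i => {J | F i ⊆ J}) = {J | ⋃ i, F i ⊆ J} := by
  induction n with
  | zero => simp [updateSeq]
  | succ k ih =>
    simp only [updateSeq]
    rw [ih fun i => F i.castSucc]
    ext J
    rw [mem_update]
    simp only [Set.mem_ofPred_eq, Set.iUnion_subset_iff]
    constructor
    · rintro ⟨I, hI, hJ, hmin⟩
      -- Adding exactly the required atoms to `I` is at least as close as any other choice, so a
      -- minimal `J` keeps all of `I`.
      have h := closerEq_iff.1 (hmin (I ∪ F (Fin.last k)) Set.subset_union_right
        (closerEq_iff.2 fun p hp => by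
          have := @hJ p
          simp only [Set.mem_union]
          tauto))
      intro i
      refine Fin.lastCases hJ (fun i p hp => ?_) i
      exact (h p (by simp [hI i hp])).1 (hI i hp)
    · intro h
      exact ⟨J, fun i => h i.castSucc, h (Fin.last k),
        fun L _ _ => closerEq_iff.2 fun p _ => Iff.rfl⟩

end Update

/-! ## Dynamic stable models -/

section Programs

variable {S : Signature.{u, v}} {n : ℕ}

namespace Literal

/-- The predicate symbol of a literal. -/
def pred : Literal S → S.Pred
  | pos p => p.pred
  | dneg p => p.pred

lemma preds_eq (L : Literal S) : L.preds = {L.pred} := by cases L <;> rfl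

lemma pred_lpnot (L : Literal S) : L.lpnot.pred = L.pred := by cases L <;> rfl

lemma lpnot_lpnot (L : Literal S) : L.lpnot.lpnot = L := by cases L <;> rfl

lemma holds_congr {I J : Interp S} {L : Literal S}
    (h : ∀ p : GroundAtom S, p.pred = L.pred → (p ∈ I ↔ p ∈ J)) : L.Holds I ↔ L.Holds J := by
  cases L with
  | pos p => exact h p rfl
  | dneg p => exact not_congr (h p rfl)

end Literal

lemma eq_least_iff {Q : Set (Rule S)} {A : Set (Literal S)} :
    A = least Q ↔ (∀ r ∈ Q, (∀ L ∈ r.body, L ∈ A) → r.head ∈ A) ∧ A ⊆ least Q := by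
  constructor
  · rintro rfl
    exact ⟨fun r hr hb => Set.mem_sInter.2 fun B hB =>
      hB r hr fun L hL => Set.mem_sInter.1 (hb L hL) B hB, subset_rfl⟩
  · rintro ⟨h, h'⟩
    exact h'.antisymm (Set.sInter_subset_of_mem h)

lemma head_mem_least {Q : Set (Rule S)} {r : Rule S} (hr : r ∈ Q)
    (hb : ∀ L ∈ r.body, L ∈ least Q) : r.head ∈ least Q :=
  (eq_least_iff.1 rfl).1 r hr hb

lemma least_subset {Q : Set (Rule S)} {A : Set (Literal S)}
    (h : ∀ r ∈ Q, (∀ L ∈ r.body, L ∈ A) → r.head ∈ A) : least Q ⊆ A :=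
  Set.sInter_subset_of_mem h

/-- Some rule at position `j` has head `H` and a body that holds in `I`. -/
def Fires (P : Fin n → Set (Rule S)) (I : Interp S) (j : Fin n) (H : Literal S) : Prop :=
  ∃ r ∈ P j, r.head = H ∧ r.BodyHolds I

/-- The program whose least model is compared with `I`. -/
def activeRules (P : Fin n → Set (Rule S)) (I : Interp S) : Set (Rule S) :=
  Prod.snd '' (allRules P \ rejected P I) ∪ defaults P I

lemma mem_activeRules {P : Fin n → Set (Rule S)} {I : Interp S} {r : Rule S} :
    r ∈ activeRules P I ↔
      (∃ i, r ∈ P i ∧ ∀ j, i ≤ j → ¬ Fires P I j r.head.lpnot) ∨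
      ∃ p, r = ⟨Literal.dneg p, ∅⟩ ∧ ∀ j, ¬ Fires P I j (Literal.pos p) := by
  refine or_congr ⟨?_, ?_⟩ (exists_congr fun p => and_congr_right fun _ => ?_)
  · rintro ⟨⟨i, r⟩, ⟨hr, hnr⟩, rfl⟩
    refine ⟨i, hr, fun j hij ⟨r', hr', hh, hb⟩ => hnr ⟨hr, j, r', hr', hij, ?_, hb⟩⟩
    rw [Rule.Conflicting, hh, Literal.lpnot_lpnot]
  · rintro ⟨i, hr, h⟩
    refine ⟨(i, r), ⟨hr, ?_⟩, rfl⟩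
    rintro ⟨-, j, r', hr', hij, hc, hb⟩
    refine h j hij ⟨r', hr', ?_, hb⟩
    have hc' : r.head = r'.head.lpnot := hc
    rw [hc', Literal.lpnot_lpnot]
  · constructor
    · rintro h j ⟨r, hr, hh, hb⟩
      exact h ⟨(j, r), hr, hh, hb⟩
    · rintro h ⟨⟨j, r⟩, hr, hh, hb⟩
      exact h j ⟨r, hr, hh, hb⟩

/-- Equality with the least model is split into closure of `I` under the active rules and
derivability of every literal true in `I`; the two halves transfer between levels by different
arguments. -/
lemma isDynamicStableModel_iff {P : Fin n → Set (Rule S)} {I : Interp S} :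
    IsDynamicStableModel P I ↔
      ((∀ i, ∀ r ∈ P i, (∀ j, i ≤ j → ¬ Fires P I j r.head.lpnot) → r.BodyHolds I →
          r.head.Holds I) ∧
        ∀ p, (∀ j, ¬ Fires P I j (Literal.pos p)) → p ∉ I) ∧
      ∀ L : Literal S, L.Holds I → L ∈ least (activeRules P I) := by
  rw [IsDynamicStableModel, ← activeRules, eq_least_iff]
  refine and_congr ⟨fun h => ⟨fun i r hr hj hb => ?_, fun p hp => ?_⟩, ?_⟩ Iff.rfl
  · exact h r (mem_activeRules.2 (Or.inl ⟨i, hr, hj⟩)) hb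
  · exact h ⟨Literal.dneg p, ∅⟩ (mem_activeRules.2 (Or.inr ⟨p, rfl, hp⟩)) (by simp)
  · rintro ⟨h₁, h₂⟩ r hr hb
    rcases mem_activeRules.1 hr with ⟨i, hr, hj⟩ | ⟨p, rfl, hp⟩
    · exact h₁ i r hr hj hb
    · exact h₂ p hp

/-- An atom that is the head of no rule is false in every dynamic stable model. -/
lemma IsDynamicStableModel.exists_head {P : Fin n → Set (Rule S)} {I : Interp S}
    (h : IsDynamicStableModel P I) {p : GroundAtom S} (hp : p ∈ I) :
    ∃ j, ∃ r ∈ P j, r.head = Literal.pos p := by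
  by_contra! hne
  exact (isDynamicStableModel_iff.1 h).1.2 p (fun j ⟨r, hr, hh, _⟩ => hne j r hr hh) hp

lemma isDynamicStableModel_facts {P : Fin n → Set (Rule S)}
    (hP : ∀ i, ∀ r ∈ P i, r.IsPositive ∧ r.IsFact) {I : Interp S} :
    IsDynamicStableModel P I ↔
      I = ⋃ i, {p | (⟨Literal.pos p, ∅⟩ : Rule S) ∈ P i} := by
  have hform : ∀ i, ∀ r ∈ P i, ∃ p, r = ⟨Literal.pos p, ∅⟩ := by
    rintro i ⟨H, B⟩ hr
    obtain ⟨⟨p, hp⟩, hB⟩ := hP i _ hr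
    exact ⟨p, congrArg₂ Rule.mk hp hB⟩
  have hpos : ∀ j p, Fires P I j (Literal.pos p) ↔ (⟨Literal.pos p, ∅⟩ : Rule S) ∈ P j := by
    refine fun j p => ⟨?_, fun h => ⟨_, h, rfl, by simp [Rule.BodyHolds]⟩⟩
    rintro ⟨r, hr, hh, -⟩
    obtain ⟨q, rfl⟩ := hform j r hr
    rwa [← (Literal.pos.inj hh : q = p)]
  have hneg : ∀ j p, ¬ Fires P I j (Literal.dneg p) := by
    rintro j p ⟨r, hr, hh, -⟩
    obtain ⟨q, rfl⟩ := hform j r hr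
    cases hh
  rw [isDynamicStableModel_iff]
  constructor
  · rintro ⟨⟨h₁, h₂⟩, -⟩
    ext p
    rw [Set.mem_iUnion]
    constructor
    · intro hp
      by_contra! hne
      exact h₂ p (fun j hj => hne j ((hpos j p).1 hj)) hp
    · rintro ⟨i, hi⟩
      exact h₁ i _ hi (fun j _ => hneg j p) (by simp [Rule.BodyHolds])
  · intro hI
    have hmem : ∀ p, p ∈ I ↔ ∃ i, (⟨Literal.pos p, ∅⟩ : Rule S) ∈ P i := fun p => by
      rw [hI, Set.mem_iUnion]
      exact Iff.rfl
    refine ⟨⟨fun i r hr _ _ => ?_, fun p hp hpI => ?_⟩, fun L hL => ?_⟩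
    · obtain ⟨p, rfl⟩ := hform i r hr
      exact (hmem p).2 ⟨i, hr⟩
    · obtain ⟨i, hi⟩ := (hmem p).1 hpI
      exact hp i ((hpos i p).2 hi)
    · cases L with
      | pos p =>
        obtain ⟨i, hi⟩ := (hmem p).1 hL
        exact head_mem_least (r := ⟨Literal.pos p, ∅⟩)
          (mem_activeRules.2 (Or.inl ⟨i, hi, fun j _ => hneg j p⟩)) (by simp)
      | dneg p =>
        exact head_mem_least (r := ⟨Literal.dneg p, ∅⟩)
          (mem_activeRules.2 (Or.inr ⟨p, rfl, fun j hj => hL ((hmem p).2 ⟨j, (hpos j p).1 hj⟩)⟩))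
          (by simp)

end Programs

/-! ## Splitting a dynamic logic program into levels -/

section Levels

variable {S : Signature.{u, v}} {n : ℕ} {ι : Type*} {β : S.Pred → ι}

/-- The part of an interpretation that lies on level `α`. -/
def levelPart (β : S.Pred → ι) (I : Interp S) (α : ι) : Interp S := {p ∈ I | β p.pred = α}

lemma holds_levelPart {I : Interp S} {α : ι} {L : Literal S} (hL : β L.pred = α) :
    L.Holds (levelPart β I α) ↔ L.Holds I :=
  Literal.holds_congr fun p hp => by simp [levelPart, hp, hL]

lemma exists_reduced (r : Rule S) (α : ι) :
    ∃ r' : Rule S, r'.head = r.head ∧ ∀ L, L ∈ r'.body ↔ L ∈ r.body ∧ β L.pred = α := by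
  classical
  exact ⟨⟨r.head, r.body.filter fun L => β L.pred = α⟩, rfl, fun L => Finset.mem_filter⟩

variable [LinearOrder ι]

/-- The rules with head on level `α` whose body literals on lower levels hold in `A`, with
these literals removed. -/
def levelProgram (β : S.Pred → ι) (P : Set (Rule S)) (α : ι) (A : Interp S) : Set (Rule S) :=
  {r' | ∃ r ∈ P, β r.head.pred = α ∧ (∀ L ∈ r.body, β L.pred < α → L.Holds A) ∧
    r'.head = r.head ∧ ∀ L, L ∈ r'.body ↔ L ∈ r.body ∧ β L.pred = α}

lemma levelProgram_congr {P : Set (Rule S)} {α : ι} {A A' : Interp S}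
    (h : ∀ p : GroundAtom S, β p.pred < α → (p ∈ A ↔ p ∈ A')) :
    levelProgram β P α A = levelProgram β P α A' := by
  ext r'
  refine exists_congr fun r => and_congr_right fun _ => and_congr_right fun _ =>
    and_congr_left fun _ => forall₂_congr fun L _ => forall_congr' fun hL =>
      Literal.holds_congr fun p hp => h p (hp ▸ hL)

/-- No body literal lies on a higher level than the head. -/
def IsLeveled (β : S.Pred → ι) (P : Fin n → Set (Rule S)) : Prop :=
  ∀ i, ∀ r ∈ P i, ∀ L ∈ r.body, β L.pred ≤ β r.head.pred

variable {P : Fin n → Set (Rule S)}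

/-- This is what makes rejection and defaults local: lower body literals are evaluated in `I` on
both sides, and the remaining ones lie on level `α` itself. -/
lemma fires_level_iff (hP : IsLeveled β P) {I : Interp S} {α : ι} {j : Fin n} {H : Literal S} (hH : β H.pred = α) :
    Fires (fun i => levelProgram β (P i) α I) (levelPart β I α) j H ↔ Fires P I j H := by
  constructor
  · rintro ⟨r', ⟨r, hr, hα, hlow, hh, hb⟩, rfl, hr'⟩
    refine ⟨r, hr, hh.symm, fun L hL => ?_⟩
    rcases (hα ▸ hP j r hr L hL).lt_or_eq with h | h
    · exact hlow L hL h
    · exact (holds_levelPart h).1 (hr' L ((hb L).2 ⟨hL, h⟩))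
  · rintro ⟨r, hr, rfl, hb⟩
    obtain ⟨r', hh, hb'⟩ := exists_reduced (β := β) r α
    exact ⟨r', ⟨r, hr, hH, fun L hL _ => hb L hL, hh, hb'⟩, hh,
      fun L hL => (holds_levelPart ((hb' L).1 hL).2).2 (hb L ((hb' L).1 hL).1)⟩

lemma IsDynamicStableModel.level (hP : IsLeveled β P) {I : Interp S}
    (h : IsDynamicStableModel P I) (α : ι) :
    IsDynamicStableModel (fun i => levelProgram β (P i) α I) (levelPart β I α) := by
  obtain ⟨⟨h₁, h₂⟩, h₃⟩ := isDynamicStableModel_iff.1 h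
  refine isDynamicStableModel_iff.2 ⟨⟨?_, ?_⟩, ?_⟩
  · rintro i r' ⟨r, hr, hα, hlow, hh, hb⟩ hrej hbody
    rw [hh] at hrej ⊢
    rw [holds_levelPart hα]
    refine h₁ i r hr (fun j hij hj => hrej j hij ((fires_level_iff hP ?_).2 hj)) fun L hL => ?_
    · rw [Literal.pred_lpnot, hα]
    · rcases (hα ▸ hP i r hr L hL).lt_or_eq with h | h
      · exact hlow L hL h
      · exact (holds_levelPart h).1 (hbody L ((hb L).2 ⟨hL, h⟩))
  · rintro p hp ⟨hpI, hpα⟩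
    exact h₂ p (fun j hj => hp j ((fires_level_iff hP (H := Literal.pos p) hpα).2 hj)) hpI
  · intro L hL
    by_cases hα : β L.pred = α
    · have hclosed : least (activeRules P I) ⊆ {L : Literal S | L.Holds I ∧ (β L.pred = α →
          L ∈ least (activeRules (fun i => levelProgram β (P i) α I) (levelPart β I α)))} := by
        refine least_subset fun r hr hb => ?_
        rcases mem_activeRules.1 hr with ⟨i, hr, hrej⟩ | ⟨p, rfl, hp⟩
        · refine ⟨h₁ i r hr hrej fun L hL => (hb L hL).1, fun hrα => ?_⟩
          obtain ⟨r', hh, hb'⟩ := exists_reduced (β := β) r α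
          rw [← hh]
          refine head_mem_least (mem_activeRules.2 (Or.inl ⟨i, ⟨r, hr, hrα,
            fun L hL _ => (hb L hL).1, hh, hb'⟩, fun j hij hj => hrej j hij ?_⟩))
            fun L hL => (hb L ((hb' L).1 hL).1).2 ((hb' L).1 hL).2
          rw [hh] at hj
          exact (fires_level_iff hP (by rw [Literal.pred_lpnot, hrα])).1 hj
        · refine ⟨h₂ p hp, fun hpα => head_mem_least (r := ⟨Literal.dneg p, ∅⟩)
            (mem_activeRules.2 (Or.inr ⟨p, rfl, fun j hj =>
              hp j ((fires_level_iff hP (H := Literal.pos p) hpα).1 hj)⟩)) (by simp)⟩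
      exact (hclosed (h₃ L ((holds_levelPart hα).1 hL))).2 hα
    · cases L with
      | pos p => exact absurd hL.2 hα
      | dneg p =>
        -- No rule of the level program has its head off level `α`, so atoms elsewhere are false by
        -- default.
        refine head_mem_least (r := ⟨Literal.dneg p, ∅⟩) (mem_activeRules.2 (Or.inr
          ⟨p, rfl, ?_⟩)) (by simp)
        rintro j ⟨r', ⟨r, -, hrα, -, hh, -⟩, hh', -⟩
        rw [← hh, hh'] at hrα
        exact hα hrα

/-- Derivations on the separate levels are stacked by well-founded induction. Only levels occupied
by a predicate are needed, since every literal lies on one. -/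
lemma IsDynamicStableModel.of_level [WellFoundedLT ι] (hP : IsLeveled β P) {I : Interp S}
    (h : ∀ Q : S.Pred, IsDynamicStableModel (fun i => levelProgram β (P i) (β Q) I)
      (levelPart β I (β Q))) : IsDynamicStableModel P I := by
  refine isDynamicStableModel_iff.2 ⟨⟨?_, ?_⟩, ?_⟩
  · intro i r hr hrej hb
    obtain ⟨⟨h₁, -⟩, -⟩ := isDynamicStableModel_iff.1 (h r.head.pred)
    obtain ⟨r', hh, hb'⟩ := exists_reduced (β := β) r (β r.head.pred)
    have := h₁ i r' ⟨r, hr, rfl, fun L hL _ => hb L hL, hh, hb'⟩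
    rw [hh, holds_levelPart rfl] at this
    exact this (fun j hij hj => hrej j hij
      ((fires_level_iff hP (by rw [Literal.pred_lpnot])).1 hj))
      fun L hL => (holds_levelPart ((hb' L).1 hL).2).2 (hb L ((hb' L).1 hL).1)
  · intro p hp hpI
    exact (isDynamicStableModel_iff.1 (h p.pred)).1.2 p
      (fun j hj => hp j ((fires_level_iff hP rfl).1 hj)) ⟨hpI, rfl⟩
  · suffices ∀ α, ∀ L : Literal S, β L.pred = α → L.Holds I → L ∈ least (activeRules P I) from
      fun L => this _ L rfl
    intro α
    induction α using WellFoundedLT.induction with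
    | ind α ih =>
      rintro L rfl hL
      set α := β L.pred with hα
      -- The level program also derives default literals for atoms of other levels; the guard `β
      -- L.pred = α` discards them.
      have hclosed : least (activeRules (fun i => levelProgram β (P i) α I) (levelPart β I α)) ⊆
          {L | β L.pred = α → L ∈ least (activeRules P I)} := by
        refine least_subset fun r' hr' hbody => ?_
        rcases mem_activeRules.1 hr' with ⟨i, ⟨r, hr, hrα, hlow, hh, hb⟩, hrej⟩ | ⟨p, rfl, hp⟩
        · intro _
          rw [hh] at hrej ⊢
          refine head_mem_least (mem_activeRules.2 (Or.inl ⟨i, hr, fun j hij hj => hrej j hij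
            ((fires_level_iff hP (by rw [Literal.pred_lpnot, hrα])).2 hj)⟩)) fun M hM => ?_
          rcases (hrα ▸ hP i r hr M hM).lt_or_eq with h | h
          · exact ih _ h M rfl (hlow M hM h)
          · exact hbody M ((hb M).2 ⟨hM, h⟩) h
        · intro hpα
          exact head_mem_least (r := ⟨Literal.dneg p, ∅⟩) (mem_activeRules.2 (Or.inr
            ⟨p, rfl, fun j hj => hp j ((fires_level_iff hP (H := Literal.pos p) hpα).2 hj)⟩)) (by simp)
      exact hclosed ((isDynamicStableModel_iff.1 (h L.pred)).2 L ((holds_levelPart rfl).2 hL)) rfl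

end Levels

/-! ## Dynamic MKNF models of basic knowledge bases -/

section Basic

variable {S : Signature.{u, v}} {D : DescriptionLogic.{u, v, w} S} {n : ℕ}

lemma HybridKB.isFirstOrder_of_mem_theory {K : HybridKB D} {φ : Sentence S}
    (h : φ ∈ K.theory) : φ.IsFirstOrder := by
  rcases h with ⟨ψ, -, rfl⟩ | ⟨p, -, rfl⟩
  · exact D.isFirstOrder_fo ψ
  · trivial

lemma HybridKB.foModels_theory_of_isProgBased {K : HybridKB D} (h : K.IsProgBased) :
    foModels K.theory = {J | {p | (⟨Literal.pos p, ∅⟩ : Rule S) ∈ K.prog} ⊆ J} := by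
  have hK : K.ont = ∅ := h
  ext J
  simp only [foModels, HybridKB.theory, hK, Set.image_empty, Set.empty_union, Set.mem_ofPred_eq]
  constructor
  · exact fun hJ p hp => hJ _ ⟨p, hp, rfl⟩
  · rintro hJ _ ⟨p, hp, rfl⟩
    exact hJ hp

namespace DynamicHybridKB

variable {K : DynamicHybridKB D n} {M : Set (Interp S)}

/-- If only positive facts are present, both ways of updating give the same result. -/
lemma exists_isDynamicStableModel_iff_eq_updateSeq (hO : K.IsOntBased) (hP : K.IsProgBased) :
    (∃ I, IsDynamicStableModel (fun i => (K i).prog) I ∧ M = {J | I ⊆ J}) ↔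
      M = updateSeq n fun i => foModels (K i).theory := by
  simp only [isDynamicStableModel_facts hO, exists_eq_left,
    HybridKB.foModels_theory_of_isProgBased (hP _), updateSeq_superset]

lemma isDynamicMKNFModel_iff_of_isOntBased (hK : K.IsOntBased) :
    K.IsDynamicMKNFModel M ↔ M.Nonempty ∧ M = updateSeq n fun i => foModels (K i).theory := by
  rw [IsDynamicMKNFModel,
    isMinimalChangeUpdateModel_iff fun i _ h => HybridKB.isFirstOrder_of_mem_theory h]
  refine and_congr_right fun hM => ⟨?_, fun h => Or.inl ⟨hK, hM, h⟩⟩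
  rintro (⟨-, -, h⟩ | ⟨hP, h⟩)
  · exact h
  · exact (exists_isDynamicStableModel_iff_eq_updateSeq hK hP).1 h

lemma isDynamicMKNFModel_iff_of_isProgBased (hK : K.IsProgBased) :
    K.IsDynamicMKNFModel M ↔
      ∃ I, IsDynamicStableModel (fun i => (K i).prog) I ∧ M = {J | I ⊆ J} := by
  rw [IsDynamicMKNFModel,
    isMinimalChangeUpdateModel_iff fun i _ h => HybridKB.isFirstOrder_of_mem_theory h]
  constructor
  · rintro ⟨-, ⟨hO, -, h⟩ | ⟨-, h⟩⟩
    · exact (exists_isDynamicStableModel_iff_eq_updateSeq hO hK).2 h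
    · exact h
  · rintro ⟨I, hI, rfl⟩
    exact ⟨⟨I, Set.Subset.rfl⟩, Or.inr ⟨hK, I, hI, rfl⟩⟩

lemma isDynamicMKNFModel_iff_of_forall_empty (hO : ∀ i, (K i).ont = ∅)
    (hP : ∀ i, (K i).prog = ∅) : K.IsDynamicMKNFModel M ↔ M = Set.univ := by
  rw [isDynamicMKNFModel_iff_of_isOntBased fun i r hr => by simp [hP] at hr]
  have h : (updateSeq n fun i => foModels (K i).theory) = Set.univ := by
    simp only [HybridKB.foModels_theory_of_isProgBased (hO _), updateSeq_superset, hP]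
    simp
  rw [h]
  exact and_iff_right_of_imp fun hM => hM ▸ Set.univ_nonempty

/-- Facts have no body predicates, hence are reducible relative to any set; empty ontologies stay
empty under restriction. -/
lemma IsBasic.isUpdateEnabling (hK : K.IsBasic) {μ : Ordinal.{x}} {U : Ordinal.{x} → Set S.Pred}
    (hU : K.IsSplittingSequence μ U) : K.IsUpdateEnabling μ U := by
  have hbody : K.IsOntBased → ∀ i, ∀ r ∈ (K i).prog, ∀ V, r.IsPositive ∧ r.bodyPreds ⊆ V := by
    intro hO i r hr V
    obtain ⟨hp, hf⟩ := hO i r hr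
    have hf' : r.body = ∅ := hf
    exact ⟨hp, by simp [Rule.bodyPreds, hf']⟩
  refine ⟨hU, fun _ => hK.imp ?_ ?_, fun α _ => hK.imp ?_ ?_⟩
  · exact fun hO i r hr => hbody hO i r hr.1 _
  · exact fun hP i => Set.subset_empty_iff.1 fun φ hφ => (hP i).subset hφ.1
  · exact fun hO i r hr => hbody hO i r hr.1.1 _
  · exact fun hP i => Set.subset_empty_iff.1 fun φ hφ => (hP i).subset hφ.1.1

end DynamicHybridKB

end Basic

/-! ## Levels of a splitting sequence -/

section Splitting

variable {S : Signature.{u, v}} {D : DescriptionLogic.{u, v, w} S} {n : ℕ}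

lemma Rule.preds_subset_iff {r : Rule S} {V : Set S.Pred} :
    r.preds ⊆ V ↔ r.head.pred ∈ V ∧ ∀ L ∈ r.body, L.pred ∈ V := by
  simp only [Rule.preds, Rule.bodyPreds, Literal.preds_eq, Set.union_subset_iff,
    Set.iUnion_subset_iff, Set.singleton_subset_iff]

namespace HybridKB

/-- Formulae and rules always contain a predicate symbol, so the bottom for `∅` is empty and no body
literal is removed. This lets stage zero be read as a reduct. -/
lemma reduct_empty (K : HybridKB D) (X : Set (Interp S)) : K.reduct ∅ X = K := by
  obtain ⟨O, P⟩ := K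
  simp only [reduct, top, bottom, HybridKB.mk.injEq]
  constructor
  · ext φ
    refine ⟨And.left, fun h => ⟨h, fun h' => ?_⟩⟩
    obtain ⟨Q, hQ⟩ := (D.fo φ).preds_nonempty
    exact h'.2 hQ
  · ext r'
    have hr : ∀ r : Rule S, (r'.body : Set (Literal S)) = {L | L ∈ r.body ∧ L.preds ⊆ ∅ᶜ} ↔
        r'.body = r.body := fun r => by
      rw [← Finset.coe_inj]
      simp
    constructor
    · rintro ⟨r, hr', -, hh, hb⟩
      obtain rfl : r' = r := by
        cases r'; cases r; exact congrArg₂ Rule.mk hh ((hr _).1 hb)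
      exact hr'.1
    · intro h
      refine ⟨r', ⟨h, fun h' => (Rule.preds_subset_iff.1 h'.2).1⟩, ?_, rfl, (hr r').2 rfl⟩
      simp [Literal.preds_eq, Models]

/-- The part of a knowledge base on level `α`, simplified by `X`. -/
def level (β : S.Pred → Ordinal.{x}) (K : HybridKB D) (α : Ordinal.{x}) (X : Set (Interp S)) :
    HybridKB D :=
  (K.bottom {Q | β Q ≤ α}).reduct {Q | β Q < α} X

/-- The level function `β` is compatible with the splitting of `K`. -/
structure IsLevelMap (K : HybridKB D) (β : S.Pred → Ordinal.{x}) : Prop where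
  ont : ∀ φ ∈ K.ont, ∀ Q ∈ D.preds φ, ∀ Q' ∈ D.preds φ, β Q = β Q'
  prog : ∀ r ∈ K.prog, ∀ L ∈ r.body, β L.pred ≤ β r.head.pred

variable {K : HybridKB D} {β : S.Pred → Ordinal.{x}} {α : Ordinal.{x}} {X : Set (Interp S)}

lemma IsLevelMap.mem_level_ont (hβ : K.IsLevelMap β) {φ : D.Stmt} :
    φ ∈ (K.level β α X).ont ↔ φ ∈ K.ont ∧ D.preds φ ⊆ β ⁻¹' {α} := by
  constructor
  · rintro ⟨⟨hφ, hle⟩, hlt⟩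
    refine ⟨hφ, fun Q hQ => (le_antisymm (hle hQ) ?_ : β Q = α)⟩
    by_contra! h
    exact hlt ⟨⟨hφ, hle⟩, fun Q' hQ' => (hβ.ont φ hφ Q' hQ' Q hQ).trans_lt h⟩
  · rintro ⟨hφ, h⟩
    refine ⟨⟨hφ, fun Q hQ => (h hQ : β Q = α).le⟩, fun h' => ?_⟩
    obtain ⟨Q, hQ⟩ := (D.fo φ).preds_nonempty
    exact (h'.2 hQ : β Q < α).ne (h hQ)

/-- The set has `A` as its least element, and `A` alone decides both `K p` and `not p`. -/
lemma models_toMKNF_iff {A : Interp S} {B : Set (Literal S)} :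
    Models {J | A ⊆ J} (Literal.toMKNF '' B) ↔ ∀ L ∈ B, L.Holds A := by
  simp only [Models, Set.forall_mem_image]
  refine forall₂_congr fun L _ => ?_
  cases L with
  | pos p => exact ⟨fun h => h A Set.Subset.rfl A Set.Subset.rfl, fun h _ _ J hJ => hJ h⟩
  | dneg p =>
    constructor
    · intro h
      obtain ⟨J, hJ, hp⟩ := h A Set.Subset.rfl
      exact fun hA => hp (hJ hA)
    · exact fun h _ _ => ⟨A, Set.Subset.rfl, h⟩

lemma IsLevelMap.mem_level_prog (hβ : K.IsLevelMap β) {r' : Rule S} :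
    r' ∈ (K.level β α X).prog ↔ ∃ r ∈ K.prog, β r.head.pred = α ∧
      Models X (Literal.toMKNF '' {L | L ∈ r.body ∧ β L.pred < α}) ∧
      r'.head = r.head ∧ ∀ L, L ∈ r'.body ↔ L ∈ r.body ∧ β L.pred = α := by
  refine exists_congr fun r => ?_
  have htop : r ∈ (top {Q | β Q < α} (K.bottom {Q | β Q ≤ α})).prog ↔
      r ∈ K.prog ∧ β r.head.pred = α := by
    constructor
    · rintro ⟨⟨hr, hle⟩, hlt⟩
      refine ⟨hr, le_antisymm (Rule.preds_subset_iff.1 hle).1 ?_⟩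
      by_contra! h
      exact hlt ⟨⟨hr, hle⟩, Rule.preds_subset_iff.2
        ⟨h, fun L hL => (hβ.prog r hr L hL).trans_lt h⟩⟩
    · rintro ⟨hr, h⟩
      exact ⟨⟨hr, Rule.preds_subset_iff.2 ⟨h.le, fun L hL => (hβ.prog r hr L hL).trans h.le⟩⟩,
        fun h' => (Rule.preds_subset_iff.1 h'.2).1.ne h⟩
  rw [htop, and_assoc]
  refine and_congr_right fun hr => and_congr_right fun hα => ?_
  simp only [Literal.preds_eq, Set.singleton_subset_iff, Set.mem_compl_iff, Set.mem_ofPred_eq,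
    Set.ext_iff, Finset.mem_coe, not_lt]
  refine and_congr_right fun _ => and_congr_right fun _ => forall_congr' fun L =>
    iff_congr Iff.rfl (and_congr_right fun hL => ?_)
  have := hα ▸ hβ.prog r hr L hL
  exact ⟨fun h => le_antisymm this h, fun h => h.ge⟩

lemma IsLevelMap.level_prog_superset (hβ : K.IsLevelMap β) {A : Interp S} :
    (K.level β α {J | A ⊆ J}).prog = levelProgram β K.prog α A := by
  ext r'
  rw [hβ.mem_level_prog]
  simp only [models_toMKNF_iff, Set.mem_ofPred_eq, and_imp]
  exact Iff.rfl

lemma IsOntBased.mem_level_prog (hK : K.IsOntBased) (hβ : K.IsLevelMap β) {r : Rule S} :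
    r ∈ (K.level β α X).prog ↔ r ∈ K.prog ∧ β r.head.pred = α := by
  rw [hβ.mem_level_prog]
  have hb : ∀ r ∈ K.prog, r.body = ∅ := fun r hr => (hK r hr).2
  constructor
  · rintro ⟨s, hs, hα, -, hh, hbody⟩
    obtain rfl : r = s := by
      have : r.body = s.body := by
        rw [hb s hs] at hbody ⊢
        exact Finset.eq_empty_of_forall_notMem fun L hL => by simpa using (hbody L).1 hL
      cases r; cases s; exact congrArg₂ Rule.mk hh this
    exact ⟨hs, hα⟩
  · rintro ⟨hr, hα⟩
    refine ⟨r, hr, hα, ?_, rfl, ?_⟩ <;> simp [hb r hr, Models]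

lemma IsOntBased.mem_level_theory (hK : K.IsOntBased) (hβ : K.IsLevelMap β) {φ : Sentence S} :
    φ ∈ (K.level β α X).theory ↔ φ ∈ K.theory ∧ φ.preds ⊆ β ⁻¹' {α} := by
  constructor
  · rintro (⟨ψ, hψ, rfl⟩ | ⟨p, hp, rfl⟩)
    · obtain ⟨h, h'⟩ := hβ.mem_level_ont.1 hψ
      exact ⟨Or.inl ⟨ψ, h, rfl⟩, h'⟩
    · obtain ⟨h, h'⟩ := (hK.mem_level_prog hβ).1 hp
      exact ⟨Or.inr ⟨p, h, rfl⟩, Set.singleton_subset_iff.2 h'⟩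
  · rintro ⟨⟨ψ, hψ, rfl⟩ | ⟨p, hp, rfl⟩, h⟩
    · exact Or.inl ⟨ψ, hβ.mem_level_ont.2 ⟨hψ, h⟩, rfl⟩
    · exact Or.inr ⟨p, (hK.mem_level_prog hβ).2 ⟨hp, h rfl⟩, rfl⟩

lemma IsOntBased.foModels_theory (hK : K.IsOntBased) (hβ : K.IsLevelMap β) {μ : Ordinal.{x}}
    (hμ : ∀ Q, β Q < μ) :
    foModels K.theory = ⋂ a : Set.Iio μ, foModels (K.level β a Set.univ).theory := by
  ext I
  simp only [foModels, Set.mem_iInter, Set.mem_ofPred_eq, hK.mem_level_theory hβ]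
  refine ⟨fun h a φ hφ => h φ hφ.1, fun h φ hφ => ?_⟩
  suffices ∃ α < μ, φ.preds ⊆ β ⁻¹' {α} by
    obtain ⟨α, hα, hs⟩ := this
    exact h ⟨α, hα⟩ φ ⟨hφ, hs⟩
  obtain ⟨Q, hQ⟩ := φ.preds_nonempty
  refine ⟨β Q, hμ Q, fun Q' hQ' => (?_ : β Q' = β Q)⟩
  rcases hφ with ⟨ψ, hψ, rfl⟩ | ⟨p, hp, rfl⟩
  · exact hβ.ont ψ hψ Q' hQ' Q hQ
  · rw [Set.mem_singleton_iff.1 hQ', Set.mem_singleton_iff.1 hQ]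

end HybridKB

namespace DynamicHybridKB

variable {K : DynamicHybridKB D n} {β : S.Pred → Ordinal.{x}} {μ : Ordinal.{x}}

/-- Every level of `K` is solved relative to the lower levels. -/
def IsLevelSolution (K : DynamicHybridKB D n) (β : S.Pred → Ordinal.{x}) (μ : Ordinal.{x})
    (X : Ordinal.{x} → Set (Interp S)) : Prop :=
  ∀ α < μ, IsDynamicMKNFModel (fun i => (K i).level β α (⋂ η < α, X η)) (X α)

lemma isDynamicMKNFModel_iff_levels_of_isOntBased (hK : K.IsOntBased)
    (hβ : ∀ i, (K i).IsLevelMap β) (hμ : ∀ Q, β Q < μ) {M : Set (Interp S)} :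
    K.IsDynamicMKNFModel M ↔
      M.Nonempty ∧ ∃ X, K.IsLevelSolution β μ X ∧ M = ⋂ α < μ, X α := by
  have htheory : ∀ i α (X : Set (Interp S)),
      ((K i).level β α X).theory = ((K i).level β α Set.univ).theory := fun i α X => by
    ext φ
    rw [(hK i).mem_level_theory (hβ i), (hK i).mem_level_theory (hβ i)]
  have hlevel : ∀ α (X : Set (Interp S)) (N : Set (Interp S)),
      IsDynamicMKNFModel (fun i => (K i).level β α X) N ↔
        N.Nonempty ∧ N = updateSeq n fun i => foModels ((K i).level β α Set.univ).theory :=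
    fun α X N => by
      rw [isDynamicMKNFModel_iff_of_isOntBased fun i r hr =>
        hK i r (((hK i).mem_level_prog (hβ i)).1 hr).1]
      simp only [htheory]
  have hsplit : (updateSeq n fun i => foModels (K i).theory) =
      ⋂ α < μ, updateSeq n fun i => foModels ((K i).level β α Set.univ).theory := by
    simp only [(hK _).foModels_theory (hβ _) hμ]
    rw [updateSeq_iInter (β := fun Q => (⟨β Q, hμ Q⟩ : Set.Iio μ)), Set.iInter_subtype]
    · rfl
    · rintro i ⟨α, hα⟩ I J hIJ hI φ hφ
      refine (φ.sat_congr (HybridKB.isFirstOrder_of_mem_theory hφ) _ fun p hp => hIJ p ?_).1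
        (hI φ hφ)
      exact Subtype.ext ((((hK i).mem_level_theory (hβ i)).1 hφ).2 hp)
  rw [isDynamicMKNFModel_iff_of_isOntBased hK, hsplit]
  refine and_congr_right fun hM => ⟨?_, ?_⟩
  · rintro rfl
    exact ⟨_, fun α hα => (hlevel _ _ _).2 ⟨hM.mono (Set.biInter_subset_of_mem hα), rfl⟩, rfl⟩
  · rintro ⟨X, hX, rfl⟩
    exact Set.iInter₂_congr fun α hα => ((hlevel _ _ _).1 (hX α hα)).2

lemma isDynamicMKNFModel_iff_levels_of_isProgBased (hK : K.IsProgBased)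
    (hβ : ∀ i, (K i).IsLevelMap β) (hμ : ∀ Q, β Q < μ) {M : Set (Interp S)} :
    K.IsDynamicMKNFModel M ↔
      M.Nonempty ∧ ∃ X, K.IsLevelSolution β μ X ∧ M = ⋂ α < μ, X α := by
  have hleveled : IsLeveled β fun i => (K i).prog := fun i => (hβ i).prog
  have hinter : ∀ (A : Ordinal.{x} → Interp S) (α : Ordinal.{x}),
      ⋂ η < α, {J | A η ⊆ J} = {J : Interp S | ⋃ η < α, A η ⊆ J} := fun A α => by
    ext J
    simp
  have hlevel : ∀ α (A : Interp S) (N : Set (Interp S)),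
      IsDynamicMKNFModel (fun i => (K i).level β α {J | A ⊆ J}) N ↔
        ∃ I, IsDynamicStableModel (fun i => levelProgram β (K i).prog α A) I ∧
          N = {J | I ⊆ J} := fun α A N => by
    rw [isDynamicMKNFModel_iff_of_isProgBased fun i => Set.subset_empty_iff.1 fun φ hφ =>
      (hK i).subset ((hβ i).mem_level_ont.1 hφ).1]
    simp only [(hβ _).level_prog_superset]
  rw [isDynamicMKNFModel_iff_of_isProgBased hK]
  constructor
  · rintro ⟨I, hI, rfl⟩
    refine ⟨⟨I, Set.Subset.rfl⟩, fun α => {J | levelPart β I α ⊆ J}, fun α _ => ?_, ?_⟩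
    · rw [hinter, hlevel]
      refine ⟨_, ?_, rfl⟩
      have := hI.level hleveled α
      convert this using 2 with i
      exact levelProgram_congr fun p hp => by simp [levelPart, hp]
    · rw [hinter]
      have : ⋃ η < μ, levelPart β I η = I := by
        ext p
        simp [levelPart, hμ]
      rw [this]
  · rintro ⟨-, X, hX, rfl⟩
    -- The value `∅` for indices from `μ` on is a dummy that makes the choice total.
    have hex : ∀ α, ∃ I : Interp S, α < μ → X α = {J | I ⊆ J} := fun α => by
      by_cases hα : α < μ
      · obtain ⟨I, -, hI⟩ := (isDynamicMKNFModel_iff_of_isProgBased (fun i =>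
          Set.subset_empty_iff.1 fun φ hφ =>
            (hK i).subset ((hβ i).mem_level_ont.1 hφ).1)).1 (hX α hα)
        exact ⟨I, fun _ => hI⟩
      · exact ⟨∅, fun h => absurd h hα⟩
    choose A hA using hex
    have hstable : ∀ α < μ,
        IsDynamicStableModel (fun i => levelProgram β (K i).prog α (⋃ η < α, A η)) (A α) := by
      intro α hα
      have h := hX α hα
      rw [Set.iInter₂_congr fun η hη => hA η (hη.trans hα), hinter, hlevel, hA α hα] at h
      obtain ⟨I, hI, hIA⟩ := h
      have : A α = I := Set.Subset.antisymm
        ((Set.ext_iff.1 hIA I).2 Set.Subset.rfl) ((Set.ext_iff.1 hIA (A α)).1 Set.Subset.rfl)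
      rwa [this]
    -- An atom true in a stable model must head some rule, and the rules of stage `α` all have heads
    -- on level `α`. Hence the union of the `A η` has `A α` as its part on level `α`.
    have hA_level : ∀ α < μ, ∀ p ∈ A α, β p.pred = α := fun α hα p hp => by
      obtain ⟨j, r', ⟨r, -, hrα, -, hh, -⟩, hh'⟩ := (hstable α hα).exists_head hp
      rw [← hh, hh'] at hrα
      exact hrα
    have hmem : ∀ ν ≤ μ, ∀ p, p ∈ ⋃ η < ν, A η ↔ β p.pred < ν ∧ p ∈ A (β p.pred) := by
      intro ν hν p
      simp only [Set.mem_iUnion, exists_prop]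
      constructor
      · rintro ⟨η, hη, hp⟩
        rw [hA_level η (hη.trans_le hν) p hp]
        exact ⟨hη, hp⟩
      · exact fun h => ⟨_, h⟩
    refine ⟨⋃ η < μ, A η, IsDynamicStableModel.of_level hleveled fun Q => ?_, ?_⟩
    · convert hstable (β Q) (hμ Q) using 2 with i
      · exact levelProgram_congr fun p hp => by simp [hmem μ le_rfl, hmem _ (hμ Q).le, hp, hμ]
      · ext p
        simp only [levelPart, Set.mem_ofPred_eq, hmem μ le_rfl]
        constructor
        · rintro ⟨⟨-, h⟩, h'⟩
          rwa [← h']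
        · intro h
          have h' := hA_level _ (hμ Q) p h
          exact ⟨⟨hμ _, h'.symm ▸ h⟩, h'⟩
    · rw [Set.iInter₂_congr hA, hinter]

/-- The level of a predicate symbol is the index at which it enters the splitting sequence. -/
lemma IsSplittingSequence.exists_level {U : Ordinal.{x} → Set S.Pred} [NeZero n]
    (hU : K.IsSplittingSequence μ U) :
    ∃ β : S.Pred → Ordinal.{x}, (∀ Q, β Q < μ) ∧ ∀ α < μ, U α = {Q | β Q ≤ α} := by
  have hU₀ := hU 0
  have hne : ∀ Q : S.Pred, {α | α < μ ∧ Q ∈ U α}.Nonempty := fun Q => by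
    have : Q ∈ ⋃ α < μ, U α := hU₀.cover ▸ Set.mem_univ Q
    obtain ⟨α, hα, hQ⟩ := Set.mem_iUnion₂.1 this
    exact ⟨α, hα, hQ⟩
  refine ⟨fun Q => sInf {α | α < μ ∧ Q ∈ U α}, fun Q => (csInf_mem (hne Q)).1, fun α hα => ?_⟩
  ext Q
  refine ⟨fun h => csInf_le' (s := {α | α < μ ∧ Q ∈ U α}) ⟨hα, h⟩, fun h => ?_⟩
  exact hU₀.monotone _ α h hα (csInf_mem (hne Q)).2

lemma IsSplittingSequence.isLevelMap {U : Ordinal.{x} → Set S.Pred}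
    (hU : K.IsSplittingSequence μ U) (hμ : ∀ Q, β Q < μ) (hβ : ∀ α < μ, U α = {Q | β Q ≤ α})
    (i : Fin n) : (K i).IsLevelMap β := by
  have hself : ∀ Q, Q ∈ U (β Q) := fun Q => by
    rw [hβ _ (hμ Q)]
    exact le_rfl (a := β Q)
  have hle : ∀ Q Q', Q' ∈ U (β Q) → β Q' ≤ β Q := fun Q Q' h => by
    rwa [hβ _ (hμ Q)] at h
  constructor
  · have : ∀ φ ∈ (K i).ont, ∀ Q ∈ D.preds φ, ∀ Q' ∈ D.preds φ, β Q' ≤ β Q :=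
      fun φ hφ Q hQ Q' hQ' =>
        hle _ _ (((hU i).splitting _ (hμ Q)).1 φ hφ ⟨Q, hQ, hself Q⟩ hQ')
    exact fun φ hφ Q hQ Q' hQ' => (this φ hφ Q' hQ' Q hQ).antisymm (this φ hφ Q hQ Q' hQ')
  · intro r hr L hL
    have h := ((hU i).splitting _ (hμ r.head.pred)).2 r hr
      ⟨r.head.pred, by rw [Literal.preds_eq]; rfl, hself _⟩
    exact hle _ _ ((Rule.preds_subset_iff.1 h).2 L hL)

/-- At zero `{Q | β Q < 0}` is empty; at `α + 1` the predicates below are those of `U α`; at a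
limit, continuity makes `{Q | β Q < α}` and `{Q | β Q ≤ α}` coincide, so nothing is left to solve.
-/
lemma isSolution_iff_isLevelSolution {U : Ordinal.{x} → Set S.Pred} [NeZero n]
    (hU : K.IsSplittingSequence μ U) (hβ : ∀ α < μ, U α = {Q | β Q ≤ α})
    {X : Ordinal.{x} → Set (Interp S)} :
    K.IsSolution μ U X ↔ K.IsLevelSolution β μ X := by
  have hzero : 0 < μ → (fun i => (K i).level β 0 (⋂ η < (0 : Ordinal.{x}), X η)) =
      K.bottom (U 0) := fun h => funext fun i => by
    have : {Q | β Q < 0} = (∅ : Set S.Pred) := by simp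
    rw [HybridKB.level, this, HybridKB.reduct_empty, ← hβ 0 h]
    rfl
  have hsucc : ∀ α, α + 1 < μ → (fun i => (K i).level β (α + 1) (⋂ η < α + 1, X η)) =
      (K.bottom (U (α + 1))).reduct (U α) (⋂ η ≤ α, X η) := fun α h => funext fun i => by
    simp only [HybridKB.level, Order.lt_add_one_iff]
    rw [← hβ _ h, ← hβ α ((Order.lt_add_one_iff.2 le_rfl).trans h)]
    rfl
  have hlimit : ∀ α < μ, Order.IsSuccLimit α → ∀ N,
      (IsDynamicMKNFModel (fun i => (K i).level β α (⋂ η < α, X η)) N ↔ N = Set.univ) := by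
    intro α hα hl N
    have hlt : {Q | β Q < α} = {Q | β Q ≤ α} := by
      rw [← hβ α hα, (hU 0).continuous α hα hl]
      ext Q
      simp only [Set.mem_iUnion, Set.mem_ofPred_eq, exists_prop]
      constructor
      · exact fun h => ⟨β Q, h, by rw [hβ _ (h.trans hα)]; exact le_rfl (a := β Q)⟩
      · rintro ⟨η, hη, hQ⟩
        rw [hβ _ (hη.trans hα)] at hQ
        exact lt_of_le_of_lt hQ hη
    refine isDynamicMKNFModel_iff_of_forall_empty (fun i => ?_) fun i => ?_
    · refine Set.subset_empty_iff.1 fun φ hφ => ?_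
      rw [HybridKB.level, hlt] at hφ
      exact hφ.2 ⟨hφ.1, hφ.1.2⟩
    · refine Set.subset_empty_iff.1 fun r' hr' => ?_
      rw [HybridKB.level, hlt] at hr'
      obtain ⟨r, hr, -⟩ := hr'
      exact hr.2 ⟨hr.1, hr.1.2⟩
  constructor
  · intro h α hα
    rcases Ordinal.zero_or_succ_or_isSuccLimit α with rfl | ⟨γ, rfl⟩ | hl
    · rw [hzero hα]
      exact h.zero hα
    · rw [Order.succ_eq_add_one] at hα ⊢
      rw [hsucc γ hα]
      exact h.succ γ hα
    · rw [hlimit α hα hl]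
      exact h.limit α hα hl
  · intro h
    refine ⟨fun α hα => (h α hα).1, fun h₀ => ?_, fun α hα => ?_, fun α hα hl => ?_⟩
    · exact hzero h₀ ▸ h 0 h₀
    · exact hsucc α hα ▸ h _ hα
    · exact (hlimit α hα hl _).1 (h α hα)

/-- For the empty sequence the splitting condition is vacuous, so `U` is arbitrary and may define no
levels; instead every stage is the set of all interpretations. -/
lemma isDynamicMKNFModelWrt_iff_of_length_zero (K : DynamicHybridKB D 0)
    {U : Ordinal.{x} → Set S.Pred} {M : Set (Interp S)} :
    K.IsDynamicMKNFModelWrt μ U M ↔ M = Set.univ := by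
  have key : ∀ (K : DynamicHybridKB D 0) (N : Set (Interp S)),
      K.IsDynamicMKNFModel N ↔ N = Set.univ := fun K N =>
    isDynamicMKNFModel_iff_of_forall_empty (fun i => i.elim0) fun i => i.elim0
  have hbasic : K.IsBasic := Or.inl fun i => i.elim0
  constructor
  · rintro ⟨-, -, X, hX, rfl⟩
    simp only [Set.iInter_eq_univ]
    intro α hα
    rcases Ordinal.zero_or_succ_or_isSuccLimit α with rfl | ⟨γ, rfl⟩ | hl
    · exact (key _ _).1 (hX.zero hα)
    · exact (key _ _).1 (hX.succ γ hα)
    · exact hX.limit α hα hl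
  · rintro rfl
    refine ⟨hbasic.isUpdateEnabling fun i => i.elim0, Set.univ_nonempty, fun _ => Set.univ,
      ⟨fun _ _ => Set.univ_nonempty, fun _ => (key _ _).2 rfl, fun _ _ => (key _ _).2 rfl,
        fun _ _ _ => rfl⟩, by simp⟩

end DynamicHybridKB

end Splitting

end HybridMKNF

theorem mainTheorem8 {S : HybridMKNF.Signature.{u, v}}
    {D : HybridMKNF.DescriptionLogic.{u, v, w} S} {n : ℕ}
    (K : HybridMKNF.DynamicHybridKB D n) (hK : K.IsBasic)
    (μ : Ordinal.{x}) (U : Ordinal.{x} → Set S.Pred) (hU : K.IsSplittingSequence μ U)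
    (M : Set (HybridMKNF.Interp S)) :
    K.IsDynamicMKNFModel M ↔ K.IsDynamicMKNFModelWrt μ U M := by
  rcases Nat.eq_zero_or_pos n with rfl | hn
  · rw [K.isDynamicMKNFModelWrt_iff_of_length_zero]
    exact HybridMKNF.DynamicHybridKB.isDynamicMKNFModel_iff_of_forall_empty
      (fun i => i.elim0) fun i => i.elim0
  · have : NeZero n := ⟨hn.ne'⟩
    obtain ⟨β, hμ, hβ⟩ := hU.exists_level
    have hlevel := hU.isLevelMap hμ hβ
    rw [HybridMKNF.DynamicHybridKB.IsDynamicMKNFModelWrt, and_iff_right (hK.isUpdateEnabling hU)]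
    simp only [HybridMKNF.DynamicHybridKB.isSolution_iff_isLevelSolution hU hβ]
    rcases hK with hO | hP
    · exact HybridMKNF.DynamicHybridKB.isDynamicMKNFModel_iff_levels_of_isOntBased hO hlevel hμ
    · exact HybridMKNF.DynamicHybridKB.isDynamicMKNFModel_iff_levels_of_isProgBased hP hlevel hμ
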